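/- **Model.** Let $a\ge 2$, $d\ge 1$. Let $X_{ik}=\mu_i+\epsilon_{ik}$ ($i=1,\dots,a$, $k=1,2,\dots$) be independent random vectors in $\mathbb R^d$ with $\mu_i\in\mathbb R^d$ such that, for fixed $i$ and $j\in\{1,\dots,d\}$, the variables $\epsilon_{ikj}$, $k\ge1$, are identically distributed with $\mathbb E(\epsilon_{ikj})=0$ and finite second moment, and $\operatorname{Var}(\epsilon_{ik})=\Sigma_i$ does not depend on $k$. Group $i$ has sample size $n_i$, $N=\sum_{i=1}^a n_i$, and as $N\to\infty$ we have $n_i/N\to\kappa_i\in(0,1]$ for every $i$. Put $\Sigma=\bigoplus_{i=1}^a\kappa_i^{-1}\Sigma_i$ and $\Sigma^{(j)}=\operatorname{diag}(\kappa_1^{-1}(\Sigma_1)_{jj},\dots,\kappa_a^{-1}(\Sigma_a)_{jj})$, let $\overline X^{(j)}=\big(n_1^{-1}\sum_{k\le n_1}X_{1kj},\dots,n_a^{-1}\sum_{k\le n_a}X_{akj}\big)^\top$, and let $P_a=I_a-\mathbf 1_a\mathbf 1_a^\top/a$. The local hypothesis $\mathcal H_0^{(j)}$ is $\mu_{1j}=\dots=\mu_{aj}$;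 the global hypothesis $\mathcal H_0$ is $\mu_1=\dots=\mu_a$. **Statistics.** Let $\widetilde M$ be an $\mathbb R^{a\times a}$-valued function of two $a\times a$ matrices such that $\widetilde M(P_a,S)$ is symmetric and positive semidefinite for every symmetric positive semidefinite $S$. For each $j$ let $\widetilde\Sigma^{(j)}$ (depending on $N$) be random matrices with $\widetilde\Sigma^{(j)}\to\Sigma^{(j)}$ and $\widetilde M(P_a,\widetilde\Sigma^{(j)})\to\widetilde M(P_a,\Sigma^{(j)})$ in probability as $N\to\infty$. Let $$\widetilde Q_{Nj}=N\cdot\frac{[P_a\overline X^{(j)}]^\top\,\widetilde M(P_a,\widetilde\Sigma^{(j)})\,[P_a\overline X^{(j)}]}{\sqrt{2\operatorname{tr}\big([P_a^\top\widetilde M(P_a,\widetilde\Sigma^{(j)})P_a\widetilde\Sigma^{(j)}]^2\big)}}$$ if the trace under the root is positive, and $\widetilde Q_{Nj}=0$ otherwise. Let $\widetilde v_{jj}=2\operatorname{tr}\big([P_a^\top\widetilde M(P_a,\Sigma^{(j)})P_a\Sigma^{(j)}]^2\big)$. Let $Z=(Z_{11},Z_{12},\dots,Z_{1d},Z_{21},\dots,Z_{ad})^\top\sim\mathcal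 N_{ad}(0,\Sigma)$, $Z^{(j)}=(Z_{1j},\dots,Z_{aj})^\top$, and, where $\widetilde v_{jj}>0$, $$\widetilde Q_j=\widetilde v_{jj}^{-1/2}\,[P_aZ^{(j)}]^\top\widetilde M(P_a,\Sigma^{(j)})P_aZ^{(j)}.$$ **Claim.** 1. If $\widetilde v_{jj}>0$ and $\mathcal H_0^{(j)}$ holds, then, as $N\to\infty$, $$\widetilde Q_{Nj}\xrightarrow{\mathcal D}\widetilde Q_j\overset{\mathcal D}{=}\frac1{\sqrt{\widetilde v_{jj}}}\sum_{i=1}^a\lambda_i\Upsilon_i,$$ where $\Upsilon_1,\dots,\Upsilon_a$ are i.i.d. $\chi^2_1$ and $\lambda_1,\dots,\lambda_a$ are the eigenvalues, with multiplicity, of the symmetric matrix $(\Sigma^{(j)})^{1/2}P_a^\top\widetilde M(P_a,\Sigma^{(j)})P_a(\Sigma^{(j)})^{1/2}$. 2. If $\widetilde v_{jj}>0$ for all $j$ and $\mathcal H_0$ holds, then $(\widetilde Q_{N1},\dots,\widetilde Q_{Nd})^\top\xrightarrow{\mathcal D}(\widetilde Q_1,\dots,\widetilde Q_d)^\top$ as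 $N\to\infty$. 3. If $\mathcal T\subseteq\{1,\dots,d\}$ is a set of indices such that $\mathcal H_0^{(j)}$ holds and $\widetilde v_{jj}>0$ for all $j\in\mathcal T$, then $(\widetilde Q_{Nj})_{j\in\mathcal T}\xrightarrow{\mathcal D}(\widetilde Q_j)_{j\in\mathcal T}$ as $N\to\infty$. -/

import Mathlib

namespace Manova

open MeasureTheory ProbabilityTheory

section Population

variable {a d : ℕ}

/-- The centering matrix `P_a = I_a - 1_a 1_aᵀ / a`. -/
noncomputable def centering (a : ℕ) : Matrix (Fin a) (Fin a) ℝ :=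
  1 - (a : ℝ)⁻¹ • Matrix.vecMulVec (fun _ => 1) (fun _ => 1)

/-- The `j`-th local hypothesis `μ_{1j} = … = μ_{aj}`. -/
def LocalNull (mu : Fin a → Fin d → ℝ) (j : Fin d) : Prop :=
  ∀ i i' : Fin a, mu i j = mu i' j

/-- The global hypothesis `μ_1 = … = μ_a`. -/
def GlobalNull (mu : Fin a → Fin d → ℝ) : Prop :=
  ∀ i i' : Fin a, mu i = mu i'

/-- `Σ^{(j)} = diag(κ_1⁻¹ (Σ_1)_{jj}, …, κ_a⁻¹ (Σ_a)_{jj})`. -/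
noncomputable def compCov (kappa : Fin a → ℝ) (Sigma : Fin a → Matrix (Fin d) (Fin d) ℝ)
    (j : Fin d) : Matrix (Fin a) (Fin a) ℝ :=
  Matrix.diagonal fun i => (kappa i)⁻¹ * Sigma i j j

/-- The direct sum `Σ = ⨁ᵢ κ_i⁻¹ Σ_i`, with rows and columns indexed by pairs
(group, component). -/
noncomputable def jointCov (kappa : Fin a → ℝ) (Sigma : Fin a → Matrix (Fin d) (Fin d) ℝ) :
    Matrix (Fin a × Fin d) (Fin a × Fin d) ℝ :=
  Matrix.of fun p q => if p.1 = q.1 then (kappa p.1)⁻¹ * Sigma p.1 p.2 q.2 else 0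

/-- `tr([P_aᵀ M̃(P_a, S) P_a S]²)`. -/
noncomputable def trSq
    (M : Matrix (Fin a) (Fin a) ℝ → Matrix (Fin a) (Fin a) ℝ → Matrix (Fin a) (Fin a) ℝ)
    (S : Matrix (Fin a) (Fin a) ℝ) : ℝ :=
  Matrix.trace
    (((centering a).transpose * M (centering a) S * centering a * S) ^ 2)

/-- The quadratic form `[P_a x]ᵀ M̃(P_a, S) [P_a x]`. -/
noncomputable def quadForm
    (M : Matrix (Fin a) (Fin a) ℝ → Matrix (Fin a) (Fin a) ℝ → Matrix (Fin a) (Fin a) ℝ)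
    (S : Matrix (Fin a) (Fin a) ℝ) (x : Fin a → ℝ) : ℝ :=
  dotProduct (Matrix.mulVec (centering a) x)
    (Matrix.mulVec (M (centering a) S) (Matrix.mulVec (centering a) x))

open scoped MatrixOrder in
/-- `S^{1/2} P_aᵀ M̃(P_a, S) P_a S^{1/2}`, with the positive semidefinite square root. -/
noncomputable def spectralMatrix
    (M : Matrix (Fin a) (Fin a) ℝ → Matrix (Fin a) (Fin a) ℝ → Matrix (Fin a) (Fin a) ℝ)
    (S : Matrix (Fin a) (Fin a) ℝ) : Matrix (Fin a) (Fin a) ℝ :=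
  CFC.sqrt S * (centering a).transpose * M (centering a) S * centering a * CFC.sqrt S

/-- The chi-square distribution with one degree of freedom: the law of the square of a standard
normal random variable. -/
noncomputable def chiSqOne : Measure ℝ :=
  (gaussianReal 0 1).map fun x => x ^ 2

end Population

section Sample

variable {a d : ℕ} {Ω : Type*}

/-- The observations `X_{ik} = μ_i + ε_{ik}`. -/
def obs (mu : Fin a → Fin d → ℝ) (eps : Fin a → ℕ → Ω → Fin d → ℝ)
    (i : Fin a) (k : ℕ) (ω : Ω) : Fin d → ℝ :=
  fun j => mu i j + eps i k ω j

/-- The component-wise mean vector `X̄^{(j)} = (n_i⁻¹ ∑_{k ≤ n_i} X_{ikj})_{i ≤ a}`; the subjects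
of a group are numbered from `0`. -/
noncomputable def compMean (X : Fin a → ℕ → Ω → Fin d → ℝ) (n : Fin a → ℕ) (j : Fin d)
    (ω : Ω) : Fin a → ℝ :=
  fun i => (n i : ℝ)⁻¹ * ∑ k ∈ Finset.range (n i), X i k ω j

open Classical in
/-- The standardized quadratic form `Q̃_{Nj}` for the sample sizes `n` (with `N = ∑ i, n i`) and
the (estimated) matrix `S` in the place of `Σ^{(j)}`; it is `0` where the indicator vanishes. -/
noncomputable def stat
    (M : Matrix (Fin a) (Fin a) ℝ → Matrix (Fin a) (Fin a) ℝ → Matrix (Fin a) (Fin a) ℝ)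
    (X : Fin a → ℕ → Ω → Fin d → ℝ) (n : Fin a → ℕ) (j : Fin d)
    (S : Ω → Matrix (Fin a) (Fin a) ℝ) (ω : Ω) : ℝ :=
  if 0 < trSq M (S ω) then
    ((∑ i, n i : ℕ) : ℝ) * (quadForm M (S ω) (compMean X n j ω) / √(2 * trSq M (S ω)))
  else 0

/-- The limit variable `Q̃_j = ṽ_{jj}^{-1/2} [P_a Z^{(j)}]ᵀ M̃(P_a, Σ^{(j)}) P_a Z^{(j)}`, where
`S = Σ^{(j)}`, `ṽ_{jj} = 2 tr([P_aᵀ M̃(P_a, S) P_a S]²)` and `Z^{(j)} = (Z_{1j}, …, Z_{aj})`. -/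
noncomputable def limitStat
    (M : Matrix (Fin a) (Fin a) ℝ → Matrix (Fin a) (Fin a) ℝ → Matrix (Fin a) (Fin a) ℝ)
    (S : Matrix (Fin a) (Fin a) ℝ) (Z : Ω → EuclideanSpace ℝ (Fin a × Fin d)) (j : Fin d)
    (ω : Ω) : ℝ :=
  (√(2 * trSq M S))⁻¹ * quadForm M S (fun i => Z ω (i, j))

end Sample

end Manova

namespace Manova

open MeasureTheory ProbabilityTheory Filter
open scoped Topology

/-! ### Taylor estimates for characteristic functions and a product limit. -/

section CharacteristicFunctions

/-! The centering matrix kills constant vectors, so under a local null the statistic is the form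
`centeredForm`, evaluated at the scaled centered mean vector `√N (X̄ - μ)` and at the estimated
matrix divided by its normalizing root (`stat_eq_centeredForm`). The mean vector converges in law to
`Z` and the normalized matrices converge in probability to constants. Slutsky's theorem, applied to
all components in `T` at once, gives the third claim (`tendstoInDistribution_stat`). The other two
are the cases of a singleton and of all indices.

The central limit theorem (`tendstoInDistribution_scaledMean`) is proved by hand, because the error
vectors of a group share a covariance matrix and componentwise laws but need not share a joint law.
Characteristic functions factor by independence. Each factor is `1 - s² v / 2` plus a remainder that
has to be `o(s²)` uniformly in the subject. `sq_mul_min_sum_le` bounds this remainder by quantities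
that involve one component at a time, and the laws of these do not depend on the subject.

For the limit law, `Z^{(j)}` is distributed as `S^{1/2}` times a standard Gaussian vector. Expanding
that vector in an eigenbasis of the spectral matrix turns the quadratic form into `∑ λ_i x_i²` with
independent standard normal `x_i`. -/

lemma norm_cexp_mul_I_sub_le (x : ℝ) :
    ‖Complex.exp (x * Complex.I) - (1 + x * Complex.I - (x : ℂ) ^ 2 / 2)‖
      ≤ 4 * (x ^ 2 * min 1 |x|) := by
  rcases le_total |x| 1 with h | h
  · rw [min_eq_right h]
    have h1 : ‖(x : ℂ) * Complex.I‖ ≤ 1 := by simpa using h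
    have h2 := Complex.exp_bound h1 (n := 3) (by norm_num)
    have h3 : ∑ m ∈ Finset.range 3, ((x : ℂ) * Complex.I) ^ m / (m.factorial : ℂ)
        = 1 + x * Complex.I - (x : ℂ) ^ 2 / 2 := by
      simp [Finset.sum_range_succ, mul_pow, Nat.factorial]
      ring
    rw [h3] at h2
    refine h2.trans ?_
    have h4 : ‖(x : ℂ) * Complex.I‖ = |x| := by simp
    rw [h4, ← sq_abs x, ← pow_succ]
    have : (0 : ℝ) ≤ |x| ^ 3 := by positivity
    norm_num [Nat.factorial]
    nlinarith
  · rw [min_eq_left h]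
    have h1 : ‖Complex.exp (x * Complex.I)‖ = 1 := Complex.norm_exp_ofReal_mul_I x
    have h2 : ‖(1 : ℂ) + x * Complex.I - (x : ℂ) ^ 2 / 2‖ ≤ 1 + |x| + |x| ^ 2 / 2 := by
      refine (norm_sub_le _ _).trans (add_le_add ((norm_add_le _ _).trans ?_) ?_) <;> simp
    refine (norm_sub_le _ _).trans ?_
    rw [h1, ← sq_abs x]
    nlinarith

/-- Exchange the factors one at a time; the untouched ones have norm at most one. -/
lemma norm_prod_sub_prod_le {ι : Type*} (s : Finset ι) (z w : ι → ℂ) (hz : ∀ i ∈ s, ‖z i‖ ≤ 1)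
    (hw : ∀ i ∈ s, ‖w i‖ ≤ 1) : ‖∏ i ∈ s, z i - ∏ i ∈ s, w i‖ ≤ ∑ i ∈ s, ‖z i - w i‖ := by
  classical
  induction s using Finset.induction_on with
  | empty => simp
  | insert i s hi ih =>
    rw [Finset.prod_insert hi, Finset.prod_insert hi, Finset.sum_insert hi]
    have hsplit : z i * ∏ x ∈ s, z x - w i * ∏ x ∈ s, w x
        = (z i - w i) * ∏ x ∈ s, z x + w i * (∏ x ∈ s, z x - ∏ x ∈ s, w x) := by ring
    have hp : ‖∏ x ∈ s, z x‖ ≤ 1 := by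
      rw [norm_prod]
      exact Finset.prod_le_one (fun _ _ => norm_nonneg _)
        fun x hx => hz x (Finset.mem_insert_of_mem hx)
    have ih' := ih (fun x hx => hz x (Finset.mem_insert_of_mem hx))
      fun x hx => hw x (Finset.mem_insert_of_mem hx)
    rw [hsplit]
    refine (norm_add_le _ _).trans (add_le_add ?_ ?_)
    · rw [norm_mul]
      exact mul_le_of_le_one_right (norm_nonneg _) hp
    · rw [norm_mul]
      exact (mul_le_of_le_one_left (norm_nonneg _) (hw i (Finset.mem_insert_self i s))).trans ih'

/-- If `φ k s = 1 - s² v / 2 + o(s²)` uniformly in `k`, then `∏_{k < n_m} φ k s_m` tends to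
`exp (- τ v / 2)` whenever `s_m → 0` and `n_m s_m² → τ`. -/
lemma tendsto_prod_exp_of_uniform_taylor {φ : ℕ → ℝ → ℂ} {δ : ℝ → ℝ} {v τ : ℝ} (hv : 0 ≤ v)
    (hφ : ∀ k s, ‖φ k s‖ ≤ 1)
    (hφδ : ∀ k s, ‖φ k s - (1 - (s : ℂ) ^ 2 * v / 2)‖ ≤ s ^ 2 * δ s)
    (hδ : Tendsto δ (𝓝 0) (𝓝 0)) {n : ℕ → ℕ} {s : ℕ → ℝ} (hs : Tendsto s atTop (𝓝 0))
    (hns : Tendsto (fun m => (n m : ℝ) * s m ^ 2) atTop (𝓝 τ)) :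
    Tendsto (fun m => ∏ k ∈ Finset.range (n m), φ k (s m)) atTop
      (𝓝 (Complex.exp (-(τ * v / 2 : ℝ)))) := by
  -- Compare with Gaussian factors, whose product is explicit. The `n m` errors add up to `n s²`
  -- times something that vanishes, and `n s²` converges.
  set w : ℕ → ℂ := fun m => Complex.exp (-(s m ^ 2 * v / 2 : ℝ)) with hw
  have hw1 : ∀ m, ‖w m‖ ≤ 1 := by
    intro m
    simp only [hw]
    rw [← Complex.ofReal_neg, Complex.norm_exp_ofReal, Real.exp_le_one_iff]
    have : 0 ≤ s m ^ 2 * v / 2 := by positivity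
    linarith
  have hmain : Tendsto (fun m => ∏ _k ∈ Finset.range (n m), w m) atTop
      (𝓝 (Complex.exp (-(τ * v / 2 : ℝ)))) := by
    have h1 : ∀ m, ∏ _k ∈ Finset.range (n m), w m
        = Complex.exp (-((n m : ℝ) * s m ^ 2 * v / 2 : ℝ)) := by
      intro m
      rw [Finset.prod_const, Finset.card_range, hw, ← Complex.exp_nat_mul]
      push_cast
      ring_nf
    simp_rw [h1]
    refine (Complex.continuous_exp.tendsto _).comp ?_
    exact ((Complex.continuous_ofReal.tendsto _).comp ((hns.mul_const v).div_const 2)).neg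
  have hdiff : Tendsto (fun m => ∏ k ∈ Finset.range (n m), φ k (s m)
      - ∏ _k ∈ Finset.range (n m), w m) atTop (𝓝 0) := by
    have hbound : Tendsto (fun m => (n m : ℝ) * s m ^ 2 * δ (s m)
        + (n m : ℝ) * s m ^ 2 * (s m ^ 2 * (v / 2) ^ 2)) atTop (𝓝 0) := by
      have h1 := hns.mul (hδ.comp hs)
      have h2 := hns.mul ((hs.pow 2).mul_const ((v / 2) ^ 2))
      simpa using h1.add h2
    refine squeeze_zero_norm' ?_ hbound
    have hsmall : Tendsto (fun m => s m ^ 2 * v / 2) atTop (𝓝 0) := by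
      simpa using ((hs.pow 2).mul_const v).div_const 2
    filter_upwards [hsmall.eventually_le_const zero_lt_one] with m hm
    refine (norm_prod_sub_prod_le _ _ _ (fun k _ => hφ k _) fun _ _ => hw1 m).trans ?_
    have hterm : ∀ k ∈ Finset.range (n m),
        ‖φ k (s m) - w m‖ ≤ s m ^ 2 * δ (s m) + (s m ^ 2 * v / 2) ^ 2 := by
      intro k _
      have h0 : 0 ≤ s m ^ 2 * v / 2 := by positivity
      have h2 : ‖(1 - (s m : ℂ) ^ 2 * v / 2) - w m‖ ≤ (s m ^ 2 * v / 2) ^ 2 := by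
        have h3 := Complex.norm_exp_sub_one_sub_id_le (x := (-(s m ^ 2 * v / 2 : ℝ) : ℂ))
          (by rw [norm_neg, Complex.norm_real, Real.norm_of_nonneg h0]; exact hm)
        rw [norm_neg, Complex.norm_real, Real.norm_of_nonneg h0] at h3
        rw [norm_sub_rev]
        have h5 : w m - (1 - (s m : ℂ) ^ 2 * v / 2)
            = Complex.exp (-(s m ^ 2 * v / 2 : ℝ)) - 1 - (-(s m ^ 2 * v / 2 : ℝ) : ℂ) := by
          simp only [hw]
          push_cast
          ring
        rw [h5]
        exact h3
      have h4 : φ k (s m) - w m = (φ k (s m) - (1 - (s m : ℂ) ^ 2 * v / 2))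
          + ((1 - (s m : ℂ) ^ 2 * v / 2) - w m) := by ring
      rw [h4]
      exact (norm_add_le _ _).trans (add_le_add (hφδ k _) h2)
    refine (Finset.sum_le_sum hterm).trans (le_of_eq ?_)
    rw [Finset.sum_const, Finset.card_range, nsmul_eq_mul]
    ring
  simpa using hdiff.add hmain

variable {Ω : Type*} [MeasurableSpace Ω] {P : Measure Ω} [IsProbabilityMeasure P]

/-- Integrate the pointwise Taylor bound; the linear term has mean zero. The minimum keeps the
remainder below a multiple of `Y²`, so no third moment is needed. -/
lemma norm_charFun_map_sub_le {Y : Ω → ℝ} (hY : MemLp Y 2 P) (hY0 : ∫ ω, Y ω ∂P = 0) (s : ℝ) :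
    ‖charFun (P.map Y) s - (1 - (s : ℂ) ^ 2 * (∫ ω, Y ω ^ 2 ∂P : ℝ) / 2)‖
      ≤ s ^ 2 * (4 * ∫ ω, Y ω ^ 2 * min 1 |s * Y ω| ∂P) := by
  have hYm : AEMeasurable Y P := hY.aestronglyMeasurable.aemeasurable
  have hY1 : Integrable Y P := hY.integrable (by norm_num)
  have hY2 : Integrable (fun ω => Y ω ^ 2) P := hY.integrable_sq
  have hexp : Integrable (fun ω => Complex.exp ((s * Y ω : ℝ) * Complex.I)) P := by
    refine Integrable.of_bound (C := 1) ?_ (ae_of_all _ fun ω => ?_)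
    · exact (by fun_prop : AEMeasurable _ P).aestronglyMeasurable
    · rw [Complex.norm_exp_ofReal_mul_I]
  have hlin : Integrable (fun ω => ((s * Y ω : ℝ) : ℂ) * Complex.I) P :=
    ((hY1.const_mul s).ofReal).mul_const _
  have hlin' : Integrable (fun ω => 1 + ((s * Y ω : ℝ) : ℂ) * Complex.I) P :=
    (integrable_const _).add hlin
  have hquad : Integrable (fun ω => ((s * Y ω : ℝ) : ℂ) ^ 2 / 2) P := by
    have := ((hY2.const_mul (s ^ 2)).ofReal (𝕜 := ℂ)).div_const 2
    refine this.congr (ae_of_all _ fun ω => ?_)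
    simp [mul_pow]
  have h1 : charFun (P.map Y) s = ∫ ω, Complex.exp ((s * Y ω : ℝ) * Complex.I) ∂P := by
    rw [charFun_apply_real, integral_map hYm (by fun_prop)]
    simp
  have h2 : (1 - (s : ℂ) ^ 2 * (∫ ω, Y ω ^ 2 ∂P : ℝ) / 2)
      = ∫ ω, (1 + ((s * Y ω : ℝ) : ℂ) * Complex.I - ((s * Y ω : ℝ) : ℂ) ^ 2 / 2) ∂P := by
    rw [integral_sub hlin' hquad,
      integral_add (integrable_const _) hlin, integral_mul_const, integral_div,
      integral_complex_ofReal, integral_const_mul, hY0]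
    have h3 : ∫ ω, ((s * Y ω : ℝ) : ℂ) ^ 2 ∂P = (s : ℂ) ^ 2 * (∫ ω, Y ω ^ 2 ∂P : ℝ) := by
      rw [← integral_complex_ofReal, ← integral_const_mul]
      congr 1
      ext ω
      push_cast
      ring
    rw [h3]
    simp
  have hall : Integrable (fun ω => 1 + ((s * Y ω : ℝ) : ℂ) * Complex.I
      - ((s * Y ω : ℝ) : ℂ) ^ 2 / 2) P := hlin'.sub hquad
  have hdom : Integrable (fun ω => Y ω ^ 2 * min 1 |s * Y ω|) P := by
    refine hY2.mono (by fun_prop) (ae_of_all _ fun ω => ?_)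
    rw [norm_mul]
    refine mul_le_of_le_one_right (norm_nonneg _) ?_
    rw [Real.norm_of_nonneg (by positivity)]
    exact min_le_left _ _
  rw [h1, h2, ← integral_sub hexp hall,
    ← integral_const_mul, ← integral_const_mul]
  refine norm_integral_le_of_norm_le ((hdom.const_mul _).const_mul _) (ae_of_all _ fun ω => ?_)
  refine (norm_cexp_mul_I_sub_le (s * Y ω)).trans (le_of_eq ?_)
  ring

lemma tendsto_integral_sq_mul_min {P : Measure Ω} {Y : Ω → ℝ} (hY : MemLp Y 2 P) :
    Tendsto (fun s : ℝ => ∫ ω, Y ω ^ 2 * min 1 |s * Y ω| ∂P) (𝓝 0) (𝓝 0) := by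
  have hYm : AEMeasurable Y P := hY.aestronglyMeasurable.aemeasurable
  have h := tendsto_integral_filter_of_dominated_convergence (μ := P) (l := 𝓝 (0 : ℝ))
    (F := fun s ω => Y ω ^ 2 * min 1 |s * Y ω|) (f := fun _ => 0) (fun ω => Y ω ^ 2)
    (Eventually.of_forall fun s => by fun_prop)
    (Eventually.of_forall fun s => ae_of_all _ fun ω => ?_) hY.integrable_sq
    (ae_of_all _ fun ω => ?_)
  · simpa using h
  · rw [Real.norm_of_nonneg (by positivity)]
    exact mul_le_of_le_one_right (by positivity) (min_le_left _ _)
  · have : Continuous fun s : ℝ => Y ω ^ 2 * min 1 |s * Y ω| := by fun_prop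
    simpa using this.tendsto 0

/-- The map `x ↦ x² min(1, |s x|)` increases with `|x|`, and the linear combination is at most `∑
|t_l|` times the largest `|e_j|`. The right side separates the components, so its mean depends only
on their marginal laws. -/
lemma sq_mul_min_sum_le {d : ℕ} (t e : Fin d → ℝ) (s : ℝ) :
    (∑ j, t j * e j) ^ 2 * min 1 |s * ∑ j, t j * e j|
      ≤ ∑ j, ((∑ l, |t l|) * e j) ^ 2 * min 1 |s * ((∑ l, |t l|) * e j)| := by
  rcases isEmpty_or_nonempty (Fin d) with h | h
  · simp
  · obtain ⟨j₀, hj₀⟩ := Finite.exists_max fun j => |e j|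
    have hC : 0 ≤ ∑ l, |t l| := Finset.sum_nonneg fun _ _ => abs_nonneg _
    have habs : |∑ j, t j * e j| ≤ |(∑ l, |t l|) * e j₀| := by
      rw [abs_mul, abs_of_nonneg hC, Finset.sum_mul]
      refine (Finset.abs_sum_le_sum_abs _ _).trans (Finset.sum_le_sum fun j _ => ?_)
      rw [abs_mul]
      exact mul_le_mul_of_nonneg_left (hj₀ j) (abs_nonneg _)
    -- The maximizing index varies with `e`, hence the sum over all components on the right.
    refine le_trans ?_ (Finset.single_le_sum
      (f := fun j => ((∑ l, |t l|) * e j) ^ 2 * min 1 |s * ((∑ l, |t l|) * e j)|)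
      (fun j _ => by positivity) (Finset.mem_univ j₀))
    refine mul_le_mul (sq_le_sq.mpr habs) (min_le_min le_rfl ?_) (by positivity) (by positivity)
    rw [abs_mul, abs_mul s]
    exact mul_le_mul_of_nonneg_left habs (abs_nonneg _)

end CharacteristicFunctions

/-! ### Joint central limit theorem for the scaled group means. -/

section JointLimit

variable {a d : ℕ} {Ω : Type*} [MeasurableSpace Ω] {P : Measure Ω}

lemma memLp_sum_mul {e : Ω → Fin d → ℝ} (he : ∀ j, MemLp (fun ω => e ω j) 2 P) (t : Fin d → ℝ) :
    MemLp (fun ω => ∑ j, t j * e ω j) 2 P :=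
  memLp_finsetSum _ fun j _ => (he j).const_mul (t j)

lemma integral_sum_mul_eq_zero [IsProbabilityMeasure P] {e : Ω → Fin d → ℝ}
    (he : ∀ j, MemLp (fun ω => e ω j) 2 P) (h0 : ∀ j, ∫ ω, e ω j ∂P = 0) (t : Fin d → ℝ) :
    ∫ ω, ∑ j, t j * e ω j ∂P = 0 := by
  rw [integral_finsetSum _ fun j _ => ((he j).integrable (by norm_num)).const_mul (t j)]
  simp [integral_const_mul, h0]

lemma integral_sum_mul_sq [IsProbabilityMeasure P] {e : Ω → Fin d → ℝ}
    (he : ∀ j, MemLp (fun ω => e ω j) 2 P) (h0 : ∀ j, ∫ ω, e ω j ∂P = 0)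
    {S : Matrix (Fin d) (Fin d) ℝ}
    (hS : ∀ j l, covariance (fun ω => e ω j) (fun ω => e ω l) P = S j l) (t : Fin d → ℝ) :
    ∫ ω, (∑ j, t j * e ω j) ^ 2 ∂P = t ⬝ᵥ S.mulVec t := by
  have hY := memLp_sum_mul he t
  rw [← variance_of_integral_eq_zero hY.aestronglyMeasurable.aemeasurable
    (integral_sum_mul_eq_zero he h0 t), ← covariance_self hY.aestronglyMeasurable.aemeasurable,
    covariance_fun_sum_fun_sum (fun j => (he j).const_mul (t j)) fun j => (he j).const_mul (t j)]
  simp only [covariance_const_mul_left, covariance_const_mul_right, hS, dotProduct,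
    Matrix.mulVec, Finset.mul_sum]
  exact Finset.sum_congr rfl fun i _ => Finset.sum_congr rfl fun j _ => by ring

/-- Central limit theorem, in terms of characteristic functions, for a linear combination of the
components of centered vectors with common covariance matrix and identically distributed
components. -/
lemma tendsto_prod_charFun_sum_mul [IsProbabilityMeasure P] {e : ℕ → Ω → Fin d → ℝ}
    (hident : ∀ j k, IdentDistrib (fun ω => e k ω j) (fun ω => e 0 ω j) P P)
    (he : ∀ k j, MemLp (fun ω => e k ω j) 2 P) (h0 : ∀ k j, ∫ ω, e k ω j ∂P = 0)
    {S : Matrix (Fin d) (Fin d) ℝ}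
    (hS : ∀ k j l, covariance (fun ω => e k ω j) (fun ω => e k ω l) P = S j l) (t : Fin d → ℝ)
    {n : ℕ → ℕ} {s : ℕ → ℝ} {τ : ℝ} (hs : Tendsto s atTop (𝓝 0))
    (hns : Tendsto (fun m => (n m : ℝ) * s m ^ 2) atTop (𝓝 τ)) :
    Tendsto (fun m => ∏ k ∈ Finset.range (n m),
      charFun (P.map fun ω => ∑ j, t j * e k ω j) (s m)) atTop
      (𝓝 (Complex.exp (-(τ * (t ⬝ᵥ S.mulVec t) / 2 : ℝ)))) := by
  set C : ℝ := ∑ l, |t l| with hC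
  have hv : 0 ≤ t ⬝ᵥ S.mulVec t := by
    rw [← integral_sum_mul_sq (he 0) (h0 0) (hS 0)]
    exact integral_nonneg fun _ => sq_nonneg _
  have hCe : ∀ k j, MemLp (fun ω => C * e k ω j) 2 P := fun k j => (he k j).const_mul C
  have hint : ∀ (s : ℝ) {Y : Ω → ℝ}, MemLp Y 2 P →
      Integrable (fun ω => Y ω ^ 2 * min 1 |s * Y ω|) P := by
    intro s Y hY
    have hYm : AEMeasurable Y P := hY.aestronglyMeasurable.aemeasurable
    refine hY.integrable_sq.mono (by fun_prop) (ae_of_all _ fun ω => ?_)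
    rw [norm_mul]
    refine mul_le_of_le_one_right (norm_nonneg _) ?_
    rw [Real.norm_of_nonneg (by positivity)]
    exact min_le_left _ _
  refine tendsto_prod_exp_of_uniform_taylor
    (φ := fun k s => charFun (P.map fun ω => ∑ j, t j * e k ω j) s)
    (δ := fun s => 4 * ∑ j, ∫ ω, (C * e 0 ω j) ^ 2 * min 1 |s * (C * e 0 ω j)| ∂P)
    hv (fun k s => ?_) (fun k s => ?_) ?_ hs hns
  · have := Measure.isProbabilityMeasure_map (μ := P)
      (memLp_sum_mul (he k) t).aestronglyMeasurable.aemeasurable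
    exact norm_charFun_le_one _
  · have h1 := norm_charFun_map_sub_le (memLp_sum_mul (he k) t)
      (integral_sum_mul_eq_zero (he k) (h0 k) t) s
    rw [integral_sum_mul_sq (he k) (h0 k) (hS k)] at h1
    refine h1.trans (mul_le_mul_of_nonneg_left
      (mul_le_mul_of_nonneg_left ?_ (by norm_num)) (sq_nonneg s))
    -- Componentwise identical distribution replaces subject `k` by subject `0`, which makes the
    -- remainder uniform in `k`.
    have h2 : ∀ j, ∫ ω, (C * e 0 ω j) ^ 2 * min 1 |s * (C * e 0 ω j)| ∂P
        = ∫ ω, (C * e k ω j) ^ 2 * min 1 |s * (C * e k ω j)| ∂P := fun j =>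
      ((hident j k).comp (u := fun x : ℝ => (C * x) ^ 2 * min 1 |s * (C * x)|)
        (by fun_prop)).integral_eq.symm
    simp_rw [h2]
    rw [← integral_finsetSum _ fun j _ => hint s (hCe k j)]
    exact integral_mono (hint s (memLp_sum_mul (he k) t))
      (integrable_finsetSum _ fun j _ => hint s (hCe k j))
      fun ω => sq_mul_min_sum_le t (e k ω) s
  · have h3 := (tendsto_finsetSum Finset.univ
      fun j _ => tendsto_integral_sq_mul_min (hCe 0 j)).const_mul 4
    simpa using h3

lemma dotProduct_jointCov_mulVec (kappa : Fin a → ℝ) (Sigma : Fin a → Matrix (Fin d) (Fin d) ℝ)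
    (t : Fin a × Fin d → ℝ) :
    t ⬝ᵥ (jointCov kappa Sigma).mulVec t
      = ∑ i, (kappa i)⁻¹ * ((fun j => t (i, j)) ⬝ᵥ (Sigma i).mulVec fun j => t (i, j)) := by
  simp only [dotProduct, Matrix.mulVec, jointCov, Matrix.of_apply, Fintype.sum_prod_type,
    ite_mul, zero_mul, Finset.sum_ite_irrel, Finset.sum_const_zero, Finset.sum_ite_eq,
    Finset.mem_univ, if_true, Finset.mul_sum]
  exact Finset.sum_congr rfl fun i _ => Finset.sum_congr rfl fun j _ =>
    Finset.sum_congr rfl fun l _ => by ring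

lemma posSemidef_jointCov {kappa : Fin a → ℝ} (hkappa : ∀ i, 0 ≤ kappa i)
    {Sigma : Fin a → Matrix (Fin d) (Fin d) ℝ} (hsymm : ∀ i j l, Sigma i j l = Sigma i l j)
    (hnonneg : ∀ i (t : Fin d → ℝ), 0 ≤ t ⬝ᵥ (Sigma i).mulVec t) :
    (jointCov kappa Sigma).PosSemidef := by
  refine Matrix.PosSemidef.of_dotProduct_mulVec_nonneg ?_ fun t => ?_
  · ext p q
    simp only [jointCov, Matrix.conjTranspose_apply, Matrix.of_apply, star_trivial]
    by_cases h : p.1 = q.1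
    · rw [if_pos h, if_pos h.symm, h, hsymm]
    · rw [if_neg h, if_neg (Ne.symm h)]
  · rw [star_trivial, dotProduct_jointCov_mulVec]
    exact Finset.sum_nonneg fun i _ => mul_nonneg (inv_nonneg.mpr (hkappa i)) (hnonneg i _)

/-- The centered and scaled vector of all component-wise means. -/
noncomputable def scaledMean (mu : Fin a → Fin d → ℝ) (eps : Fin a → ℕ → Ω → Fin d → ℝ)
    (n : Fin a → ℕ) (ω : Ω) : EuclideanSpace ℝ (Fin a × Fin d) :=
  WithLp.toLp 2 fun p => √((∑ i, n i : ℕ) : ℝ) * (compMean (obs mu eps) n p.2 ω p.1 - mu p.1 p.2)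

/-- An empty group must be excluded: its mean is `0` by the convention `0⁻¹ = 0`, and `mu` would not
cancel. -/
lemma compMean_obs_sub {Ω : Type*} (mu : Fin a → Fin d → ℝ) (eps : Fin a → ℕ → Ω → Fin d → ℝ)
    {n : Fin a → ℕ} {i : Fin a} (hi : n i ≠ 0) (j : Fin d) (ω : Ω) :
    compMean (obs mu eps) n j ω i - mu i j
      = (n i : ℝ)⁻¹ * ∑ k ∈ Finset.range (n i), eps i k ω j := by
  have : (n i : ℝ) ≠ 0 := by exact_mod_cast hi
  simp only [compMean, obs, Finset.sum_add_distrib, Finset.sum_const, Finset.card_range,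
    nsmul_eq_mul]
  field_simp
  ring

lemma measurable_scaledMean {mu : Fin a → Fin d → ℝ} {eps : Fin a → ℕ → Ω → Fin d → ℝ}
    (heps : ∀ i k, Measurable (eps i k)) (n : Fin a → ℕ) : Measurable (scaledMean mu eps n) := by
  have h : ∀ i k j, Measurable fun ω => eps i k ω j := fun i k j =>
    (measurable_pi_apply j).comp (heps i k)
  refine (WithLp.measurable_toLp 2 _).comp (measurable_pi_lambda _ fun p => ?_)
  simp only [compMean, obs]
  fun_prop

/-- The inner product with `t` is a sum of independent real variables, one per subject; the scale
`√N / n_i` moves into the argument. -/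
lemma charFun_map_scaledMean [IsProbabilityMeasure P] {mu : Fin a → Fin d → ℝ}
    {eps : Fin a → ℕ → Ω → Fin d → ℝ} (heps : ∀ i k, Measurable (eps i k))
    (hindep : iIndepFun (fun p : Fin a × ℕ => eps p.1 p.2) P) {n : Fin a → ℕ}
    (hn : ∀ i, n i ≠ 0) (t : EuclideanSpace ℝ (Fin a × Fin d)) :
    charFun (P.map (scaledMean mu eps n)) t
      = ∏ i, ∏ k ∈ Finset.range (n i), charFun (P.map fun ω => ∑ j, t (i, j) * eps i k ω j)
          (√((∑ i, n i : ℕ) : ℝ) / n i) := by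
  have h : ∀ i k j, Measurable fun ω => eps i k ω j := fun i k j =>
    (measurable_pi_apply j).comp (heps i k)
  set c : Fin a → ℝ := fun i => √((∑ i, n i : ℕ) : ℝ) / n i with hc
  -- A sigma type indexes the subjects, so that sums and products over groups of unequal size split
  -- into iterated ones.
  set U : (Σ _ : Fin a, ℕ) → Ω → ℝ :=
    fun p ω => c p.1 * ∑ j, t (p.1, j) * eps p.1 p.2 ω j with hU
  have hUm : ∀ p, Measurable (U p) := fun p => by
    simp only [hU]
    fun_prop
  have hUindep : iIndepFun U P := by
    have h1 := hindep.precomp (g := fun p : (Σ _ : Fin a, ℕ) => (p.1, p.2))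
      (fun p q hpq => by
        obtain ⟨i, k⟩ := p
        obtain ⟨i', k'⟩ := q
        simpa [Prod.ext_iff] using hpq)
    exact h1.comp (fun p x => c p.1 * ∑ j, t (p.1, j) * x j) fun p => by fun_prop
  set s : Finset (Σ _ : Fin a, ℕ) := Finset.univ.sigma fun i => Finset.range (n i) with hs
  have hinner : ∀ ω, inner ℝ (scaledMean mu eps n ω) t = ∑ p ∈ s, U p ω := by
    intro ω
    rw [hs, Finset.sum_sigma, PiLp.inner_apply, Fintype.sum_prod_type]
    refine Finset.sum_congr rfl fun i _ => ?_
    simp only [hU, ← Finset.mul_sum]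
    rw [Finset.sum_comm, Finset.mul_sum]
    refine Finset.sum_congr rfl fun j _ => ?_
    rw [← Finset.mul_sum]
    simp only [scaledMean, compMean_obs_sub mu eps (hn i), hc]
    simp
    ring
  have h1 : charFun (P.map (scaledMean mu eps n)) t
      = charFun (P.map fun ω => ∑ p ∈ s, U p ω) 1 := by
    rw [charFun_apply, charFun_apply_real,
      integral_map (measurable_scaledMean heps n).aemeasurable (by fun_prop),
      integral_map (by fun_prop) (by fun_prop)]
    simp [hinner]
  rw [h1, (hUindep.restrict s).charFun_map_fun_finsetSum_eq_prod fun p _ => (hUm p).aemeasurable,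
    Finset.prod_apply, hs, Finset.prod_sigma]
  refine Finset.prod_congr rfl fun i _ => Finset.prod_congr rfl fun k _ => ?_
  simp only [hU]
  rw [charFun_map_mul_comp (by fun_prop), mul_one]

lemma tendstoInDistribution_scaledMean [IsProbabilityMeasure P] {mu : Fin a → Fin d → ℝ}
    {eps : Fin a → ℕ → Ω → Fin d → ℝ} {Sigma : Fin a → Matrix (Fin d) (Fin d) ℝ}
    (heps_meas : ∀ i k, Measurable (eps i k))
    (heps_indep : iIndepFun (fun p : Fin a × ℕ => eps p.1 p.2) P)
    (heps_ident : ∀ i j k l, IdentDistrib (fun ω => eps i k ω j) (fun ω => eps i l ω j) P P)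
    (heps_sq : ∀ i k j, MemLp (fun ω => eps i k ω j) 2 P)
    (heps_mean : ∀ i k j, ∫ ω, eps i k ω j ∂P = 0)
    (heps_cov : ∀ i k j l,
      covariance (fun ω => eps i k ω j) (fun ω => eps i k ω l) P = Sigma i j l)
    {n : ℕ → Fin a → ℕ} {kappa : Fin a → ℝ}
    (hN : Tendsto (fun m => ∑ i, n m i) atTop atTop) (hkappa : ∀ i, 0 < kappa i)
    (hn : ∀ i, Tendsto (fun m => (n m i : ℝ) / ((∑ i', n m i' : ℕ) : ℝ)) atTop (𝓝 (kappa i)))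
    {Ω' : Type*} [MeasurableSpace Ω'] {P' : Measure Ω'} [IsProbabilityMeasure P']
    {Z : Ω' → EuclideanSpace ℝ (Fin a × Fin d)}
    (hZ : HasLaw Z (multivariateGaussian 0 (jointCov kappa Sigma)) P')
    (hPSD : (jointCov kappa Sigma).PosSemidef) :
    TendstoInDistribution (fun m => scaledMean mu eps (n m)) atTop Z (fun _ => P) P' where
  forall_aemeasurable m := (measurable_scaledMean heps_meas (n m)).aemeasurable
  aemeasurable_limit := hZ.aemeasurable
  tendsto := by
    have hNR : Tendsto (fun m => ((∑ i, n m i : ℕ) : ℝ)) atTop atTop :=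
      tendsto_natCast_atTop_atTop.comp hN
    -- Positivity of `κ_i` forces every group to grow.
    have hnR : ∀ i, Tendsto (fun m => (n m i : ℝ)) atTop atTop := by
      intro i
      refine ((hn i).pos_mul_atTop (hkappa i) hNR).congr' ?_
      filter_upwards [hNR.eventually_gt_atTop 0] with m hm
      exact div_mul_cancel₀ _ hm.ne'
    refine ProbabilityMeasure.tendsto_iff_tendsto_charFun.2 fun t => ?_
    have hlim : charFun (P'.map Z) t = ∏ i, Complex.exp (-((kappa i)⁻¹ *
        ((fun j => t (i, j)) ⬝ᵥ (Sigma i).mulVec fun j => t (i, j)) / 2 : ℝ)) := by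
      rw [hZ.map_eq, charFun_multivariateGaussian hPSD, ← Complex.exp_sum,
        dotProduct_jointCov_mulVec]
      simp [Finset.sum_neg_distrib, Finset.sum_div]
    have hgroup : ∀ i, Tendsto (fun m => ∏ k ∈ Finset.range (n m i),
        charFun (P.map fun ω => ∑ j, t (i, j) * eps i k ω j)
          (√((∑ i, n m i : ℕ) : ℝ) / n m i)) atTop
        (𝓝 (Complex.exp (-((kappa i)⁻¹ *
          ((fun j => t (i, j)) ⬝ᵥ (Sigma i).mulVec fun j => t (i, j)) / 2 : ℝ)))) := by
      intro i
      -- With `s = √N / n_i` one has `n_i s² = N / n_i`, the source of the weight `κ_i⁻¹`.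
      have hns : Tendsto (fun m => (n m i : ℝ) * (√((∑ i, n m i : ℕ) : ℝ) / n m i) ^ 2) atTop
          (𝓝 (kappa i)⁻¹) := by
        refine ((hn i).inv₀ (hkappa i).ne').congr' ?_
        filter_upwards [(hnR i).eventually_gt_atTop 0] with m hm
        rw [div_pow, Real.sq_sqrt (Nat.cast_nonneg _)]
        field_simp
      have hs : Tendsto (fun m => √((∑ i, n m i : ℕ) : ℝ) / n m i) atTop (𝓝 0) := by
        have h1 : Tendsto (fun m => √((n m i : ℝ) * (√((∑ i, n m i : ℕ) : ℝ) / n m i) ^ 2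
            * (n m i : ℝ)⁻¹)) atTop (𝓝 0) := by
          have := (hns.mul (tendsto_inv_atTop_zero.comp (hnR i))).sqrt
          simpa using this
        refine h1.congr' ?_
        filter_upwards [(hnR i).eventually_gt_atTop 0] with m hm
        rw [mul_right_comm, mul_inv_cancel₀ hm.ne', one_mul, Real.sqrt_sq (by positivity)]
      exact tendsto_prod_charFun_sum_mul (fun j k => heps_ident i j k 0) (heps_sq i)
        (heps_mean i) (heps_cov i) (fun j => t (i, j)) hs hns
    have hprod := tendsto_finsetProd Finset.univ fun i _ => hgroup i
    rw [← hlim] at hprod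
    refine hprod.congr' ?_
    have hpos : ∀ᶠ m in atTop, ∀ i, n m i ≠ 0 := by
      rw [eventually_all]
      intro i
      filter_upwards [(hnR i).eventually_gt_atTop 0] with m hm
      exact_mod_cast hm.ne'
    filter_upwards [hpos] with m hm
    exact (charFun_map_scaledMean heps_meas heps_indep hm t).symm

end JointLimit

/-! ### Convergence in probability: pairs, finite families, continuous maps. -/

section ConvergenceInMeasure

variable {Ω ι E F : Type*} [MeasurableSpace Ω] {P : Measure Ω} {l : Filter ι}

lemma tendstoInMeasure_prodMk [PseudoEMetricSpace E] [PseudoEMetricSpace F] {f : ι → Ω → E}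
    {g : ι → Ω → F} {f₀ : Ω → E} {g₀ : Ω → F} (hf : TendstoInMeasure P f l f₀)
    (hg : TendstoInMeasure P g l g₀) :
    TendstoInMeasure P (fun i ω => (f i ω, g i ω)) l fun ω => (f₀ ω, g₀ ω) := by
  intro ε hε
  have h := (hf ε hε).add (hg ε hε)
  rw [add_zero] at h
  refine tendsto_of_tendsto_of_tendsto_of_le_of_le tendsto_const_nhds h (fun _ => zero_le)
    fun i => (measure_mono fun ω hω => ?_).trans (measure_union_le _ _)
  simpa [Prod.edist_eq, le_max_iff] using hω

lemma tendstoInMeasure_pi {κ : Type*} [Fintype κ] {E : κ → Type*}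
    [∀ k, PseudoEMetricSpace (E k)] {f : ι → Ω → ∀ k, E k} {g : Ω → ∀ k, E k}
    (h : ∀ k, TendstoInMeasure P (fun i ω => f i ω k) l fun ω => g ω k) :
    TendstoInMeasure P f l g := by
  intro ε hε
  have hsum := tendsto_finsetSum Finset.univ fun k _ => h k ε hε
  rw [Finset.sum_const_zero] at hsum
  refine tendsto_of_tendsto_of_tendsto_of_le_of_le tendsto_const_nhds hsum (fun _ => zero_le)
    fun i => (measure_mono fun ω hω => ?_).trans (measure_biUnion_finset_le _ _)
  simp only [Set.mem_iUnion, Finset.mem_univ, exists_prop, true_and, Set.mem_ofPred_eq] at hω ⊢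
  by_contra! hlt
  exact absurd hω (not_le.mpr ((Finset.sup_lt_iff hε).mpr fun k _ => hlt k))

/-- As the limit is constant, continuity at that one point suffices; this suits `normalized`, which
has a cutoff. -/
lemma tendstoInMeasure_comp_of_continuousAt [PseudoMetricSpace E] [PseudoMetricSpace F]
    {f : ι → Ω → E} {c : E} (hf : TendstoInMeasure P f l fun _ => c) {g : E → F}
    (hg : ContinuousAt g c) : TendstoInMeasure P (fun i ω => g (f i ω)) l fun _ => g c := by
  rw [tendstoInMeasure_iff_dist] at hf ⊢
  intro ε hε
  obtain ⟨δ, hδ, hball⟩ := Metric.continuousAt_iff.mp hg ε hε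
  refine tendsto_of_tendsto_of_tendsto_of_le_of_le tendsto_const_nhds (hf δ hδ)
    (fun _ => zero_le) fun i => measure_mono fun ω hω => ?_
  by_contra hlt
  exact absurd (hball (not_le.mp hlt)) (not_lt.mpr hω)

end ConvergenceInMeasure

/-! ### Studentization by the estimated trace and Slutsky's theorem. -/

section Studentization

variable {a d : ℕ}

/-- `tr([P_aᵀ A P_a S]²)` as a function of the two matrices `A` and `S`. -/
noncomputable def trSqOf (A S : Fin a → Fin a → ℝ) : ℝ :=
  Matrix.trace (((centering a).transpose * Matrix.of A * centering a * Matrix.of S) ^ 2)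

open Classical in
/-- The matrix `A / √(2 tr([P_aᵀ A P_a S]²))`, and `0` if the trace is not positive. -/
noncomputable def normalized (p : (Fin a → Fin a → ℝ) × (Fin a → Fin a → ℝ)) :
    Fin a → Fin a → ℝ :=
  fun r s => if 0 < trSqOf p.1 p.2 then p.1 r s / √(2 * trSqOf p.1 p.2) else 0

lemma continuous_trSqOf :
    Continuous fun p : (Fin a → Fin a → ℝ) × (Fin a → Fin a → ℝ) => trSqOf p.1 p.2 := by
  unfold trSqOf
  have h1 : Continuous fun p : (Fin a → Fin a → ℝ) × (Fin a → Fin a → ℝ) => Matrix.of p.1 :=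
    continuous_fst
  have h2 : Continuous fun p : (Fin a → Fin a → ℝ) × (Fin a → Fin a → ℝ) => Matrix.of p.2 :=
    continuous_snd
  fun_prop

/-- Positivity of the trace is an open condition, so the cutoff is inactive near `p`. -/
lemma continuousAt_normalized {p : (Fin a → Fin a → ℝ) × (Fin a → Fin a → ℝ)}
    (hp : 0 < trSqOf p.1 p.2) : ContinuousAt normalized p := by
  refine continuousAt_pi.mpr fun r => continuousAt_pi.mpr fun s => ?_
  have htr := continuous_trSqOf.continuousAt (x := p)
  have h1 : ContinuousAt (fun q : (Fin a → Fin a → ℝ) × (Fin a → Fin a → ℝ) =>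
      q.1 r s / √(2 * trSqOf q.1 q.2)) p := by
    refine ContinuousAt.div (by fun_prop) (htr.const_mul 2).sqrt ?_
    exact (Real.sqrt_pos.mpr (by linarith)).ne'
  refine h1.congr ?_
  filter_upwards [htr.eventually_const_lt hp] with q hq
  simp [normalized, hq]

lemma measurable_normalized :
    Measurable (normalized : (Fin a → Fin a → ℝ) × (Fin a → Fin a → ℝ) → _) := by
  refine measurable_pi_lambda _ fun r => measurable_pi_lambda _ fun s => ?_
  have htr := (continuous_trSqOf (a := a)).measurable
  refine Measurable.ite (measurableSet_lt measurable_const htr) ?_ measurable_const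
  exact (by fun_prop : Measurable fun q : (Fin a → Fin a → ℝ) × (Fin a → Fin a → ℝ) =>
    q.1 r s).div ((htr.const_mul 2).sqrt)

/-- The quadratic form `[P_a x]ᵀ A [P_a x]`. -/
noncomputable def centeredForm (A : Fin a → Fin a → ℝ) (x : Fin a → ℝ) : ℝ :=
  (centering a).mulVec x ⬝ᵥ (Matrix.of A).mulVec ((centering a).mulVec x)

lemma continuous_centeredForm :
    Continuous fun p : (Fin a → Fin a → ℝ) × (Fin a → ℝ) => centeredForm p.1 p.2 := by
  unfold centeredForm
  have h1 : Continuous fun p : (Fin a → Fin a → ℝ) × (Fin a → ℝ) => Matrix.of p.1 :=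
    continuous_fst
  have h2 : Continuous fun p : (Fin a → Fin a → ℝ) × (Fin a → ℝ) =>
      (centering a).mulVec p.2 := Continuous.matrix_mulVec continuous_const continuous_snd
  exact Continuous.dotProduct h2 (Continuous.matrix_mulVec h1 h2)

lemma centering_mulVec_of_const {x : Fin a → ℝ} (hx : ∀ i i', x i = x i') :
    (centering a).mulVec x = 0 := by
  ext i
  -- The row index `i` already witnesses `a ≠ 0`.
  have ha : (a : ℝ) ≠ 0 := by exact_mod_cast (Fin.pos i).ne'
  have h1 : ∑ i', x i' = a * x i := by
    rw [Finset.sum_congr rfl fun i' _ => hx i' i]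
    simp
  rw [centering, Matrix.sub_mulVec, Matrix.one_mulVec, Matrix.smul_mulVec]
  simp only [Pi.sub_apply, Pi.smul_apply, Matrix.mulVec, dotProduct, Matrix.vecMulVec_apply,
    one_mul, smul_eq_mul, h1, Pi.zero_apply]
  field_simp
  ring

lemma centeredForm_normalized
    (M : Matrix (Fin a) (Fin a) ℝ → Matrix (Fin a) (Fin a) ℝ → Matrix (Fin a) (Fin a) ℝ)
    (S : Matrix (Fin a) (Fin a) ℝ) (hS : 0 < trSq M S) (x : Fin a → ℝ) :
    centeredForm (normalized (M (centering a) S, S)) x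
      = quadForm M S x / √(2 * trSq M S) := by
  have h1 : trSqOf (M (centering a) S) S = trSq M S := rfl
  have h2 : Matrix.of (normalized (M (centering a) S, S))
      = (√(2 * trSq M S))⁻¹ • M (centering a) S := by
    ext r s
    simp [normalized, h1, hS, div_eq_inv_mul]
  rw [centeredForm, h2, Matrix.smul_mulVec, dotProduct_smul, smul_eq_mul, quadForm,
    inv_mul_eq_div]

/-- The factor `N` splits into one `√N` for each argument of the form, and the null lets `mu` be
subtracted for free inside the centering. Where the trace is not positive, both sides vanish. -/
lemma stat_eq_centeredForm {Ω : Type*}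
    (M : Matrix (Fin a) (Fin a) ℝ → Matrix (Fin a) (Fin a) ℝ → Matrix (Fin a) (Fin a) ℝ)
    {mu : Fin a → Fin d → ℝ} (eps : Fin a → ℕ → Ω → Fin d → ℝ) (n : Fin a → ℕ) {j : Fin d}
    (hj : LocalNull mu j) (S : Ω → Matrix (Fin a) (Fin a) ℝ) (ω : Ω) :
    stat M (obs mu eps) n j S ω
      = centeredForm (normalized (M (centering a) (S ω), S ω))
          fun i => scaledMean mu eps n ω (i, j) := by
  by_cases h : 0 < trSq M (S ω)
  · rw [centeredForm_normalized M _ h, stat, if_pos h, ← mul_div_assoc]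
    congr 1
    have h1 : (fun i => scaledMean mu eps n ω (i, j))
        = √((∑ i, n i : ℕ) : ℝ) • (compMean (obs mu eps) n j ω - fun i => mu i j) := by
      ext i
      simp [scaledMean]
    have h2 : (centering a).mulVec (fun i => scaledMean mu eps n ω (i, j))
        = √((∑ i, n i : ℕ) : ℝ) • (centering a).mulVec (compMean (obs mu eps) n j ω) := by
      rw [h1, Matrix.mulVec_smul, Matrix.mulVec_sub, centering_mulVec_of_const hj, sub_zero]
    rw [quadForm, quadForm, h2, Matrix.mulVec_smul, smul_dotProduct, dotProduct_smul,
      smul_eq_mul, smul_eq_mul, ← mul_assoc, Real.mul_self_sqrt (Nat.cast_nonneg _)]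
  · have h2 : normalized (M (centering a) (S ω), S ω) = 0 := by
      ext r s
      exact if_neg h
    rw [h2, stat, if_neg h, centeredForm]
    have : (Matrix.of (0 : Fin a → Fin a → ℝ)) = (0 : Matrix (Fin a) (Fin a) ℝ) := rfl
    rw [this, Matrix.zero_mulVec, dotProduct_zero]

/-- Slutsky's theorem for the studentized quadratic forms over a set of true local hypotheses. -/
lemma tendstoInDistribution_stat {Ω : Type*} [MeasurableSpace Ω] {P : Measure Ω}
    [IsProbabilityMeasure P] {mu : Fin a → Fin d → ℝ} {eps : Fin a → ℕ → Ω → Fin d → ℝ}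
    {n : ℕ → Fin a → ℕ}
    {M : Matrix (Fin a) (Fin a) ℝ → Matrix (Fin a) (Fin a) ℝ → Matrix (Fin a) (Fin a) ℝ}
    {S : Fin d → Matrix (Fin a) (Fin a) ℝ} {SHat : Fin d → ℕ → Ω → Matrix (Fin a) (Fin a) ℝ}
    (hSHat_meas : ∀ j m r s, Measurable fun ω => SHat j m ω r s)
    (hSHat : ∀ j r s, TendstoInMeasure P (fun m ω => SHat j m ω r s) atTop (fun _ => S j r s))
    (hMHat_meas : ∀ j m r s, Measurable fun ω => M (centering a) (SHat j m ω) r s)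
    (hMHat : ∀ j r s, TendstoInMeasure P
      (fun m ω => M (centering a) (SHat j m ω) r s) atTop (fun _ => M (centering a) (S j) r s))
    {Ω' : Type*} [MeasurableSpace Ω'] {P' : Measure Ω'} [IsProbabilityMeasure P']
    {Z : Ω' → EuclideanSpace ℝ (Fin a × Fin d)}
    (hmean : TendstoInDistribution (fun m => scaledMean mu eps (n m)) atTop Z (fun _ => P) P')
    (T : Set (Fin d)) (hT : ∀ j ∈ T, LocalNull mu j) (hv : ∀ j ∈ T, 0 < trSq M (S j)) :
    TendstoInDistribution (fun m ω (j : T) => stat M (obs mu eps) (n m) j.1 (SHat j.1 m) ω) atTop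
      (fun ω (j : T) => limitStat M (S j.1) Z j.1 ω) (fun _ => P) P' := by
  have : Fintype T := Fintype.ofFinite T
  set c : ℕ → Ω → T → Fin a → Fin a → ℝ :=
    fun m ω j => normalized (M (centering a) (SHat j.1 m ω), SHat j.1 m ω) with hc
  set c₀ : T → Fin a → Fin a → ℝ := fun j => normalized (M (centering a) (S j.1), S j.1) with hc₀
  -- Entrywise convergence to constants suffices for the whole family. No continuity of `M` is used,
  -- since `M` at the estimator converges by assumption.
  have hlim : TendstoInMeasure P c atTop fun _ => c₀ := by
    refine tendstoInMeasure_pi fun j => ?_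
    have hpair : TendstoInMeasure P (E := (Fin a → Fin a → ℝ) × (Fin a → Fin a → ℝ))
        (fun m ω => (M (centering a) (SHat j.1 m ω), SHat j.1 m ω)) atTop
        fun _ => (M (centering a) (S j.1), S j.1) :=
      tendstoInMeasure_prodMk (E := Fin a → Fin a → ℝ) (F := Fin a → Fin a → ℝ)
        (tendstoInMeasure_pi fun r => tendstoInMeasure_pi fun s => hMHat j.1 r s)
        (tendstoInMeasure_pi fun r => tendstoInMeasure_pi fun s => hSHat j.1 r s)
    exact tendstoInMeasure_comp_of_continuousAt hpair (continuousAt_normalized (hv j.1 j.2))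
  have hmeas : ∀ m, AEMeasurable (c m) P := by
    intro m
    refine (measurable_pi_lambda _ fun j => ?_).aemeasurable
    exact measurable_normalized.comp (Measurable.prodMk
      (measurable_pi_lambda _ fun r => measurable_pi_lambda _ fun s => hMHat_meas j.1 m r s)
      (measurable_pi_lambda _ fun r => measurable_pi_lambda _ fun s => hSHat_meas j.1 m r s))
  have hcont : Continuous fun (p : EuclideanSpace ℝ (Fin a × Fin d) × (T → Fin a → Fin a → ℝ))
      (j : T) => centeredForm (p.2 j) fun i => p.1 (i, j.1) := by
    refine continuous_pi fun j => continuous_centeredForm.comp (Continuous.prodMk ?_ ?_)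
    · fun_prop
    · fun_prop
  have h := hmean.continuous_comp_prodMk_of_tendstoInMeasure_const hcont hlim hmeas
  have h1 : (fun m ω (j : T) => stat M (obs mu eps) (n m) j.1 (SHat j.1 m) ω)
      = fun m ω (j : T) => centeredForm (c m ω j) fun i => scaledMean mu eps (n m) ω (i, j.1) := by
    funext m ω j
    exact stat_eq_centeredForm M eps (n m) (hT j.1 j.2) _ _
  have h2 : (fun ω (j : T) => limitStat M (S j.1) Z j.1 ω)
      = fun ω (j : T) => centeredForm (c₀ j) fun i => Z ω (i, j.1) := by
    funext ω j
    simp only [hc₀]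
    rw [centeredForm_normalized M _ (hv j.1 j.2), limitStat, inv_mul_eq_div]
  rw [h1, h2]
  exact h

end Studentization

/-! ### The limit law as a weighted sum of chi-square variables. -/

section LimitLaw

variable {a d : ℕ}

lemma compCov_eq_submatrix (kappa : Fin a → ℝ) (Sigma : Fin a → Matrix (Fin d) (Fin d) ℝ)
    (j : Fin d) :
    compCov kappa Sigma j
      = (jointCov kappa Sigma).submatrix (fun i => (i, j)) fun i => (i, j) := by
  ext i i'
  by_cases h : i = i'
  · subst h
    simp [compCov, jointCov]
  · simp [compCov, jointCov, h]

lemma posSemidef_compCov {kappa : Fin a → ℝ} {Sigma : Fin a → Matrix (Fin d) (Fin d) ℝ}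
    (h : (jointCov kappa Sigma).PosSemidef) (j : Fin d) : (compCov kappa Sigma j).PosSemidef := by
  rw [compCov_eq_submatrix]
  exact h.submatrix _

/-- The components `Z^{(j)}` of a centered Gaussian vector with covariance matrix `Σ` form a
centered Gaussian vector with covariance matrix `Σ^{(j)}`. -/
lemma hasLaw_component {kappa : Fin a → ℝ} {Sigma : Fin a → Matrix (Fin d) (Fin d) ℝ}
    (h : (jointCov kappa Sigma).PosSemidef) {Ω' : Type*} [MeasurableSpace Ω'] {P' : Measure Ω'}
    [IsProbabilityMeasure P'] {Z : Ω' → EuclideanSpace ℝ (Fin a × Fin d)}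
    (hZ : HasLaw Z (multivariateGaussian 0 (jointCov kappa Sigma)) P') (j : Fin d) :
    HasLaw (fun ω => (WithLp.toLp 2 fun i => Z ω (i, j) : EuclideanSpace ℝ (Fin a)))
      (multivariateGaussian 0 (compCov kappa Sigma j)) P' := by
  have hf : Continuous fun z : EuclideanSpace ℝ (Fin a × Fin d) =>
      (WithLp.toLp 2 fun i => z (i, j) : EuclideanSpace ℝ (Fin a)) := by fun_prop
  have hmp : MeasurePreserving (fun z : EuclideanSpace ℝ (Fin a × Fin d) =>
      (WithLp.toLp 2 fun i => z (i, j) : EuclideanSpace ℝ (Fin a)))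
      (multivariateGaussian 0 (jointCov kappa Sigma))
      (multivariateGaussian 0 (compCov kappa Sigma j)) := by
    refine ⟨hf.measurable, ?_⟩
    have := Measure.isProbabilityMeasure_map (μ := multivariateGaussian 0 (jointCov kappa Sigma))
      hf.measurable.aemeasurable
    refine Measure.ext_of_charFun ?_
    ext t
    -- The extension of `t` by zero off component `j`, adjoint to the projection.
    set u : EuclideanSpace ℝ (Fin a × Fin d) :=
      WithLp.toLp 2 fun p => if p.2 = j then t p.1 else 0 with hu
    have h1 : charFun ((multivariateGaussian 0 (jointCov kappa Sigma)).map
        fun z : EuclideanSpace ℝ (Fin a × Fin d) =>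
          (WithLp.toLp 2 fun i => z (i, j) : EuclideanSpace ℝ (Fin a))) t
        = charFun (multivariateGaussian 0 (jointCov kappa Sigma)) u := by
      rw [charFun_apply, charFun_apply, integral_map hf.measurable.aemeasurable (by fun_prop)]
      congr 1
      ext z
      congr 3
      simp [PiLp.inner_apply, Fintype.sum_prod_type, hu]
    rw [h1, charFun_multivariateGaussian h, charFun_multivariateGaussian (posSemidef_compCov h j),
      dotProduct_jointCov_mulVec]
    simp only [inner_zero_right]
    congr 3
    norm_cast
    simp only [hu, compCov, dotProduct, Matrix.mulVec]
    simp [Matrix.diagonal_apply]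
    exact Finset.sum_congr rfl fun i _ => by ring
  exact hmp.comp_hasLaw hZ

open scoped MatrixOrder in
-- The matrix is a congruence `(P_a S^{1/2})ᵀ M (P_a S^{1/2})`.
lemma isHermitian_spectralMatrix
    {M : Matrix (Fin a) (Fin a) ℝ → Matrix (Fin a) (Fin a) ℝ → Matrix (Fin a) (Fin a) ℝ}
    {S : Matrix (Fin a) (Fin a) ℝ} (hM : (M (centering a) S).IsHermitian) :
    (spectralMatrix M S).IsHermitian := by
  have hR : (CFC.sqrt S).IsHermitian := (CFC.sqrt_nonneg S).isSelfAdjoint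
  have h1 : spectralMatrix M S
      = (centering a * CFC.sqrt S).conjTranspose * M (centering a) S
        * (centering a * CFC.sqrt S) := by
    rw [Matrix.conjTranspose_mul, hR.eq, Matrix.conjTranspose_eq_transpose_of_trivial,
      spectralMatrix]
    simp only [Matrix.mul_assoc]
  rw [h1]
  exact Matrix.isHermitian_conjTranspose_mul_mul _ hM

open scoped MatrixOrder in
lemma quadForm_sqrt_mulVec
    (M : Matrix (Fin a) (Fin a) ℝ → Matrix (Fin a) (Fin a) ℝ → Matrix (Fin a) (Fin a) ℝ)
    (S : Matrix (Fin a) (Fin a) ℝ) (x : Fin a → ℝ) :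
    quadForm M S ((CFC.sqrt S).mulVec x) = x ⬝ᵥ (spectralMatrix M S).mulVec x := by
  have hR : (CFC.sqrt S).transpose = CFC.sqrt S := by
    have h : (CFC.sqrt S).IsHermitian := (CFC.sqrt_nonneg S).isSelfAdjoint
    rw [← Matrix.conjTranspose_eq_transpose_of_trivial, h.eq]
  have h1 : spectralMatrix M S = (centering a * CFC.sqrt S).transpose
      * (M (centering a) S * (centering a * CFC.sqrt S)) := by
    rw [Matrix.transpose_mul, hR, spectralMatrix]
    simp only [Matrix.mul_assoc]
  rw [h1, ← Matrix.mulVec_mulVec, Matrix.dotProduct_mulVec, Matrix.vecMul_transpose,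
    quadForm, Matrix.mulVec_mulVec, Matrix.mulVec_mulVec]

lemma dotProduct_mulVec_sum_eigenvectorBasis {A : Matrix (Fin a) (Fin a) ℝ}
    (hA : A.IsHermitian) (x : Fin a → ℝ) :
    (∑ i, x i • hA.eigenvectorBasis i).ofLp
        ⬝ᵥ A.mulVec (∑ i, x i • hA.eigenvectorBasis i).ofLp
      = ∑ i, hA.eigenvalues i * x i ^ 2 := by
  have h1 : ∀ i, Matrix.toEuclideanCLM (𝕜 := ℝ) A (hA.eigenvectorBasis i)
      = hA.eigenvalues i • hA.eigenvectorBasis i := by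
    intro i
    apply WithLp.ofLp_injective
    rw [Matrix.ofLp_toEuclideanCLM, hA.mulVec_eigenvectorBasis]
    rfl
  rw [← Matrix.inner_toEuclideanCLM, map_sum]
  simp only [map_smul, h1, smul_smul]
  rw [hA.eigenvectorBasis.orthonormal.inner_sum]
  exact Finset.sum_congr rfl fun i _ => by simp; ring

lemma continuous_quadForm
    (M : Matrix (Fin a) (Fin a) ℝ → Matrix (Fin a) (Fin a) ℝ → Matrix (Fin a) (Fin a) ℝ)
    (S : Matrix (Fin a) (Fin a) ℝ) : Continuous (quadForm M S) := by
  have hP : Continuous fun x : Fin a → ℝ => (centering a).mulVec x :=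
    Continuous.matrix_mulVec continuous_const continuous_id
  exact Continuous.dotProduct hP (Continuous.matrix_mulVec continuous_const hP)

/-- A standard Gaussian vector has independent standard normal coordinates in every orthonormal
basis; the eigenbasis of the spectral matrix diagonalizes the form. -/
lemma map_quadForm_multivariateGaussian
    (M : Matrix (Fin a) (Fin a) ℝ → Matrix (Fin a) (Fin a) ℝ → Matrix (Fin a) (Fin a) ℝ)
    (S : Matrix (Fin a) (Fin a) ℝ) (hA : (spectralMatrix M S).IsHermitian) :
    (multivariateGaussian 0 S).map (fun z : EuclideanSpace ℝ (Fin a) => quadForm M S z.ofLp)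
      = (Measure.pi fun _ : Fin a => gaussianReal 0 1).map
          fun x => ∑ i, hA.eigenvalues i * x i ^ 2 := by
  have hquad : Measurable fun z : EuclideanSpace ℝ (Fin a) => quadForm M S z.ofLp :=
    ((continuous_quadForm M S).comp (PiLp.continuous_ofLp 2 _)).measurable
  rw [multivariateGaussian, stdGaussian_eq_map_pi_orthonormalBasis hA.eigenvectorBasis,
    Measure.map_map hquad (by fun_prop),
    Measure.map_map (hquad.comp (by fun_prop)) (by fun_prop)]
  congr 1
  ext x
  simp only [Function.comp_apply, zero_add]
  rw [Matrix.ofLp_toEuclideanCLM, quadForm_sqrt_mulVec,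
    dotProduct_mulVec_sum_eigenvectorBasis]

lemma hasLaw_pi_chiSqOne {Ω'' : Type*} [MeasurableSpace Ω''] {P'' : Measure Ω''}
    [IsProbabilityMeasure P''] {Υ : Fin a → Ω'' → ℝ} (hΥ_indep : iIndepFun Υ P'')
    (hΥ_law : ∀ i, HasLaw (Υ i) chiSqOne P'') :
    HasLaw (fun ω i => Υ i ω) ((Measure.pi fun _ : Fin a => gaussianReal 0 1).map
      fun x i => x i ^ 2) P'' := by
  have hm : Measurable fun x : ℝ => x ^ 2 := by fun_prop
  have : IsProbabilityMeasure ((gaussianReal 0 1).map fun x => x ^ 2) :=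
    Measure.isProbabilityMeasure_map hm.aemeasurable
  have hchi := Measure.pi_map_pi (μ := fun _ : Fin a => gaussianReal 0 1)
    (f := fun _ x => x ^ 2) fun _ => hm.aemeasurable
  rw [hchi]
  exact hΥ_indep.hasLaw_pi hΥ_law

/-- The limit variable has the law of a weighted sum of independent chi-square variables, the
weights being the eigenvalues of the spectral matrix. -/
lemma identDistrib_limitStat
    (M : Matrix (Fin a) (Fin a) ℝ → Matrix (Fin a) (Fin a) ℝ → Matrix (Fin a) (Fin a) ℝ)
    {S : Matrix (Fin a) (Fin a) ℝ} (hA : (spectralMatrix M S).IsHermitian)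
    {Ω' : Type*} [MeasurableSpace Ω'] {P' : Measure Ω'}
    {Z : Ω' → EuclideanSpace ℝ (Fin a × Fin d)} {j : Fin d}
    (hZj : HasLaw (fun ω => (WithLp.toLp 2 fun i => Z ω (i, j) : EuclideanSpace ℝ (Fin a)))
      (multivariateGaussian 0 S) P')
    {Ω'' : Type*} [MeasurableSpace Ω''] {P'' : Measure Ω''} [IsProbabilityMeasure P'']
    {Υ : Fin a → Ω'' → ℝ} (hΥ_indep : iIndepFun Υ P'')
    (hΥ_law : ∀ i, HasLaw (Υ i) chiSqOne P'') :
    IdentDistrib (limitStat M S Z j)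
      (fun ω => 1 / √(2 * trSq M S) * ∑ i, hA.eigenvalues i * Υ i ω) P' P'' := by
  have hquad : Measurable fun z : EuclideanSpace ℝ (Fin a) => quadForm M S z.ofLp :=
    ((continuous_quadForm M S).comp (PiLp.continuous_ofLp 2 _)).measurable
  have hsum : Measurable fun y : Fin a → ℝ => ∑ i, hA.eigenvalues i * y i := by fun_prop
  have hΥ := hasLaw_pi_chiSqOne hΥ_indep hΥ_law
  have hident : IdentDistrib (fun ω => quadForm M S fun i => Z ω (i, j))
      (fun ω => ∑ i, hA.eigenvalues i * Υ i ω) P' P'' := by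
    have hl : HasLaw (fun ω => quadForm M S fun i => Z ω (i, j))
        ((Measure.pi fun _ : Fin a => gaussianReal 0 1).map
          fun x => ∑ i, hA.eigenvalues i * x i ^ 2) P' :=
      HasLaw.fun_comp (Y := fun z : EuclideanSpace ℝ (Fin a) => quadForm M S z.ofLp)
        ⟨hquad.aemeasurable, map_quadForm_multivariateGaussian M S hA⟩ hZj
    have hr : HasLaw (fun ω => ∑ i, hA.eigenvalues i * Υ i ω)
        ((Measure.pi fun _ : Fin a => gaussianReal 0 1).map
          fun x => ∑ i, hA.eigenvalues i * x i ^ 2) P'' :=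
      HasLaw.fun_comp (Y := fun y : Fin a → ℝ => ∑ i, hA.eigenvalues i * y i)
        ⟨hsum.aemeasurable, Measure.map_map hsum (by fun_prop)⟩ hΥ
    exact ⟨hl.aemeasurable, hr.aemeasurable, hl.map_eq.trans hr.map_eq.symm⟩
  have h3 := hident.comp (u := fun x => (√(2 * trSq M S))⁻¹ * x) (by fun_prop)
  rw [one_div]
  exact h3

end LimitLaw

end Manova

/-! ### Deduction of the three claims. -/

theorem mainTheorem7
    {a d : ℕ} (ha : 2 ≤ a)
    {Ω : Type*} [MeasurableSpace Ω] (P : MeasureTheory.Measure Ω)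
    [MeasureTheory.IsProbabilityMeasure P]
    -- the model: expectation vectors, independent errors, covariance matrices
    (mu : Fin a → Fin d → ℝ)
    (eps : Fin a → ℕ → Ω → Fin d → ℝ)
    (Sigma : Fin a → Matrix (Fin d) (Fin d) ℝ)
    (heps_meas : ∀ i k, Measurable (eps i k))
    (heps_indep : ProbabilityTheory.iIndepFun (fun p : Fin a × ℕ => eps p.1 p.2) P)
    (heps_ident : ∀ i j k l, ProbabilityTheory.IdentDistrib
      (fun ω => eps i k ω j) (fun ω => eps i l ω j) P P)
    (heps_sq : ∀ i k j, MeasureTheory.MemLp (fun ω => eps i k ω j) 2 P)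
    (heps_mean : ∀ i k j, ∫ ω, eps i k ω j ∂P = 0)
    (heps_cov : ∀ i k j l,
      ProbabilityTheory.covariance (fun ω => eps i k ω j) (fun ω => eps i k ω l) P = Sigma i j l)
    -- the sample sizes along the sequence `m → ∞`
    (n : ℕ → Fin a → ℕ) (kappa : Fin a → ℝ)
    (hN : Filter.Tendsto (fun m => ∑ i, n m i) Filter.atTop Filter.atTop)
    (hkappa : ∀ i, kappa i ∈ Set.Ioc (0 : ℝ) 1)
    (hn : ∀ i, Filter.Tendsto (fun m => (n m i : ℝ) / ((∑ i', n m i' : ℕ) : ℝ))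
      Filter.atTop (nhds (kappa i)))
    -- the matrix-valued function and the consistent estimators of the matrices `Σ^{(j)}`
    (M : Matrix (Fin a) (Fin a) ℝ → Matrix (Fin a) (Fin a) ℝ → Matrix (Fin a) (Fin a) ℝ)
    (hM : ∀ S : Matrix (Fin a) (Fin a) ℝ, S.PosSemidef → (M (Manova.centering a) S).PosSemidef)
    (SigmaHat : Fin d → ℕ → Ω → Matrix (Fin a) (Fin a) ℝ)
    (hSigmaHat_meas : ∀ j m r s, Measurable fun ω => SigmaHat j m ω r s)
    (hSigmaHat : ∀ j r s, MeasureTheory.TendstoInMeasure P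
      (fun m ω => SigmaHat j m ω r s) Filter.atTop
      (fun _ => Manova.compCov kappa Sigma j r s))
    (hMHat_meas : ∀ j m r s, Measurable fun ω => M (Manova.centering a) (SigmaHat j m ω) r s)
    (hMHat : ∀ j r s, MeasureTheory.TendstoInMeasure P
      (fun m ω => M (Manova.centering a) (SigmaHat j m ω) r s) Filter.atTop
      (fun _ => M (Manova.centering a) (Manova.compCov kappa Sigma j) r s))
    -- the Gaussian vector `Z ∼ N(0, Σ)`
    {Ω' : Type*} [MeasurableSpace Ω'] (P' : MeasureTheory.Measure Ω')
    [MeasureTheory.IsProbabilityMeasure P']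
    (Z : Ω' → EuclideanSpace ℝ (Fin a × Fin d))
    (hZ : ProbabilityTheory.HasLaw Z
      (ProbabilityTheory.multivariateGaussian 0 (Manova.jointCov kappa Sigma)) P')
    -- independent chi-square variables with one degree of freedom
    {Ω'' : Type*} [MeasurableSpace Ω''] (P'' : MeasureTheory.Measure Ω'')
    [MeasureTheory.IsProbabilityMeasure P'']
    (Υ : Fin a → Ω'' → ℝ)
    (hΥ_indep : ProbabilityTheory.iIndepFun Υ P'')
    (hΥ_law : ∀ i, ProbabilityTheory.HasLaw (Υ i) Manova.chiSqOne P'') :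
    -- each component under its local hypothesis
    (∀ j : Fin d, Manova.LocalNull mu j →
      0 < 2 * Manova.trSq M (Manova.compCov kappa Sigma j) →
      MeasureTheory.TendstoInDistribution
        (fun m => Manova.stat M (Manova.obs mu eps) (n m) j (SigmaHat j m)) Filter.atTop
        (Manova.limitStat M (Manova.compCov kappa Sigma j) Z j) (fun _ => P) P' ∧
      ∃ hA : (Manova.spectralMatrix M (Manova.compCov kappa Sigma j)).IsHermitian,
        ProbabilityTheory.IdentDistrib
          (Manova.limitStat M (Manova.compCov kappa Sigma j) Z j)
          (fun ω => 1 / √(2 * Manova.trSq M (Manova.compCov kappa Sigma j)) *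
            ∑ i, hA.eigenvalues i * Υ i ω) P' P'') ∧
    -- the whole vector under the global hypothesis
    (Manova.GlobalNull mu →
      (∀ j : Fin d, 0 < 2 * Manova.trSq M (Manova.compCov kappa Sigma j)) →
      MeasureTheory.TendstoInDistribution
        (fun m ω (j : Fin d) => Manova.stat M (Manova.obs mu eps) (n m) j (SigmaHat j m) ω)
        Filter.atTop
        (fun ω (j : Fin d) => Manova.limitStat M (Manova.compCov kappa Sigma j) Z j ω)
        (fun _ => P) P') ∧
    -- the subvector over a set of true local hypotheses
    (∀ T : Set (Fin d), (∀ j ∈ T, Manova.LocalNull mu j) →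
      (∀ j ∈ T, 0 < 2 * Manova.trSq M (Manova.compCov kappa Sigma j)) →
      MeasureTheory.TendstoInDistribution
        (fun m ω (j : T) =>
          Manova.stat M (Manova.obs mu eps) (n m) j.1 (SigmaHat j.1 m) ω)
        Filter.atTop
        (fun ω (j : T) => Manova.limitStat M (Manova.compCov kappa Sigma j.1) Z j.1 ω)
        (fun _ => P) P') := by
  have hkappa' : ∀ i, 0 < kappa i := fun i => (hkappa i).1
  -- Semidefiniteness is inherited from the model: `t ⬝ᵥ Σ_i t` is the second moment of a linear
  -- combination of the errors of subject `0`.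
  have hPSD : (Manova.jointCov kappa Sigma).PosSemidef := by
    refine Manova.posSemidef_jointCov (fun i => (hkappa' i).le) (fun i j l => ?_) fun i t => ?_
    · rw [← heps_cov i 0 j l, ← heps_cov i 0 l j, ProbabilityTheory.covariance_comm]
    · rw [← Manova.integral_sum_mul_sq (heps_sq i 0) (heps_mean i 0) (heps_cov i 0)]
      exact MeasureTheory.integral_nonneg fun _ => sq_nonneg _
  have hmean := Manova.tendstoInDistribution_scaledMean (mu := mu) heps_meas heps_indep heps_ident
    heps_sq heps_mean heps_cov hN hkappa' hn hZ hPSD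
  have hsub := Manova.tendstoInDistribution_stat (M := M) hSigmaHat_meas hSigmaHat hMHat_meas
    hMHat hmean
  refine ⟨fun j hj hv => ⟨?_, ?_⟩, fun hnull hv => ?_, fun T hT hv =>
    hsub T hT fun j hj => by linarith [hv j hj]⟩
  -- Take `T = {j}` and evaluate at its only index.
  · have h := hsub {j} (fun j' hj' => hj' ▸ hj) fun j' hj' => by
      rw [Set.mem_singleton_iff.mp hj']
      linarith
    exact h.continuous_comp (g := fun x : (({j} : Set (Fin d)) → ℝ) => x ⟨j, rfl⟩)
      (continuous_apply _)
  · have hA := Manova.isHermitian_spectralMatrix (M := M)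
      (hM _ (Manova.posSemidef_compCov hPSD j)).isHermitian
    exact ⟨hA, Manova.identDistrib_limitStat M hA (Manova.hasLaw_component hPSD hZ j)
      hΥ_indep hΥ_law⟩
  -- Take `T` to be everything, then reindex continuously from the subtype to `Fin d`.
  · have h := hsub Set.univ (fun j _ i i' => congrFun (hnull i i') j) fun j _ => by
      linarith [hv j]
    exact h.continuous_comp (g := fun (x : ↥(Set.univ : Set (Fin d)) → ℝ) (j : Fin d) =>
      x ⟨j, trivial⟩) (by fun_prop)
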